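/- **Setting.** Let $n$ be the security parameter. All algorithms (honest parties, adversaries, simulators, distinguishers) are families of Boolean circuits of size polynomial in $n$, with uniform random coins where applicable and with oracle gates for a hash function $H$ (non-uniform polynomial time; distinguishers are deterministic, which is no restriction). Fix, for each $n$: a finite field $\mathbb F$ and a dimension $\theta$; a universe $\mathcal U$ and key spaces $K_{\mathsf{emb}}$, $K_\pi$; an embedding $\mathsf{embed}: K_{\mathsf{emb}}\times\mathcal U\to\mathbb F^\theta$; and a keyed permutation $\pi: K_\pi\times\mathbb F^\theta\to\mathbb F^\theta$ (each $\pi_k$ is a bijection). All these sets have injective binary encodings of fixed length polynomial in $n$; $\mathsf{embed}$ and $\pi$ are computed by polynomial-size circuits, and so is membership of a string in the set of encodings of elements of $\mathcal U$. The hash function $H:\{0,1\}^*\to\mathbb F^\theta$ is either a random oracle or any fixed function; everybody, including the simulators and the distinguishers, only has oracle access to it. **Functionalities.** $\mathcal F_{\mathsf{EM}}$: the server $\mathsf S$ inputs $k_{\mathsf e}\in K_{\mathsf{emb}}$ and $k_1,k_2\in K_\pi$, the client $\mathsf C$ inputs $x\in\mathcal U$; $\mathsf C$ learns $$p_1=\pi_{k_1}(\mathsf{embed}_{k_{\mathsf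 e}}(x)),\qquad p_2=\pi_{k_2}\bigl(H(x,\mathsf{embed}_{k_{\mathsf e}}(x),k_{\mathsf e})\bigr),$$ and $\mathsf S$ learns nothing; a client that inputs a string that does not encode an element of $\mathcal U$ gets $\bot$. $\mathcal F_{\mathsf{GC}}$, for a public family of circuits $C$ (with gates for $H$): the server (garbler) inputs a string $a$, the client (evaluator) a string $b$; the client learns $C(a,b)$ and the server learns nothing. **Protocol $\Pi_{\mathsf{EM}}$.** $\mathsf S$ as garbler with input $(k_{\mathsf e},k_1,k_2)$ and $\mathsf C$ as evaluator with input $x$ evaluate the circuit $C_{\mathsf{EM}}$ that computes $v=\mathsf{embed}_{k_{\mathsf e}}(x)$ and outputs $p_1=\pi_{k_1}(v)$ and $p_2=\pi_{k_2}(H(x,v,k_{\mathsf e}))$ to $\mathsf C$ (and $\bot$ if $\mathsf C$'s input string does not encode an element of $\mathcal U$). In the $\mathcal F_{\mathsf{GC}}$-hybrid model this is one call of $\mathcal F_{\mathsf{GC}}$ for $C_{\mathsf{EM}}$; given a garbled-circuit construction $\rho$, i.e. a two-party protocol $\rho(C)$ for every circuit family $C$, the protocol $\Pi_{\mathsf{EM}}^{\rho}$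 is $\rho(C_{\mathsf{EM}})$ on these inputs. **Secure realization.** A protocol *securely realizes* $\mathcal F$ *against a semi-honest server and a malicious client* if its honest parties run in polynomial time and, for stand-alone static corruption: 1. (semi-honest server) there is a polynomial-time simulator which, from the server's input alone, outputs a view such that for all inputs of the two parties the simulated view, jointly with the output that $\mathcal F$ prescribes for the client and with acceptance of the server, is computationally indistinguishable from the server's real view jointly with the real outputs of client and server; 2. (malicious client) for every polynomial-time adversary in the place of the client there is a polynomial-time adversary in the ideal process for $\mathcal F$ such that, for all inputs of the parties and all auxiliary inputs of polynomial length, the output of the adversary jointly with that of the honest server (accept or abort) in the real execution is computationally indistinguishable from the pair of outputs in the ideal process. In the ideal process the adversary chooses one input for $\mathcal F$, receives the output of $\mathcal F$ on it and on the server's input, and then decides whether the server accepts or aborts. Computationally indistinguishable means that every polynomial-time distinguisher has advantage negligible in $n$. **Theorem.** In the $\mathcal F_{\mathsf{GC}}$-hybrid model, $\Pi_{\mathsf{EM}}$ securely realizes $\mathcal F_{\mathsf{EM}}$ against a semi-honest server and a malicious client. Moreover, if $\rho$ is a garbled-circuit construction (in the plain model, or in a hybrid model with some other functionality) such that, for every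 polynomial-size circuit family $C$, $\rho(C)$ securely realizes $\mathcal F_{\mathsf{GC}}$ for $C$ against a semi-honest garbler and a malicious evaluator, then $\Pi_{\mathsf{EM}}^{\rho}$ securely realizes $\mathcal F_{\mathsf{EM}}$ against a semi-honest server and a malicious client. -/

import Mathlib

/-! Two-party computation with a semi-honest server and a malicious client, in the presence of a
hash function.  Algorithms are families of circuits with hash gates, indexed by the security
parameter `n`; "polynomial time" is non-uniform: polynomial circuit size. -/

/-- Bit strings of length `n`. -/
abbrev Bits (n : ℕ) : Type := Fin n → Bool

def PolyBounded (f : ℕ → ℕ) : Prop := ∃ p : Polynomial ℕ, ∀ n, f n ≤ p.eval n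

/-- Vanishing faster than the inverse of every polynomial in the security parameter. -/
def Negligible (f : ℕ → ℝ) : Prop :=
  Asymptotics.SuperpolynomialDecay Filter.atTop (fun n : ℕ => (n : ℝ)) f

/-! ### Circuits -/

/-- Boolean circuits with `a` input and `b` output wires, over (bitwise) NAND gates and hash gates.
A hash gate returns the `m` bits of the hash value of the bit string on its input wires. -/
inductive Circ (m : ℕ) : ℕ → ℕ → Type where
  /-- rewiring: output `i` is input `f i` -/
  | wire {a b : ℕ} (f : Fin b → Fin a) : Circ m a b
  /-- constant output -/
  | const {a b : ℕ} (v : Bits b) : Circ m a b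
  /-- `k` parallel NAND gates -/
  | nand (k : ℕ) : Circ m (k + k) k
  /-- one hash gate -/
  | hash (k : ℕ) : Circ m k m
  /-- composition, the first circuit first -/
  | seq {a b c : ℕ} (C : Circ m a b) (D : Circ m b c) : Circ m a c
  /-- both circuits on the same input, outputs concatenated -/
  | pair {a b c : ℕ} (C : Circ m a b) (D : Circ m a c) : Circ m a (b + c)

namespace Circ

/-- The function computed by a circuit when the hash gates answer according to `H`. -/
def eval {m : ℕ} (H : List Bool → Bits m) : {a b : ℕ} → Circ m a b → Bits a → Bits b
  | _, _, wire f, x => fun i => x (f i)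
  | _, _, const v, _ => v
  | _, _, nand k, x => fun i => !(x (Fin.castAdd k i) && x (Fin.natAdd k i))
  | _, _, hash _, x => H (List.ofFn x)
  | _, _, seq C D, x => D.eval H (C.eval H x)
  | _, _, pair C D, x => Fin.append (C.eval H x) (D.eval H x)

/-- The number of gates; a hash gate counts with its input and output length, and a rewiring or a
constant with its number of output wires. -/
def size {m : ℕ} : {a b : ℕ} → Circ m a b → ℕ
  | _, b, wire _ => b
  | _, b, const _ => b
  | _, _, nand k => k
  | _, _, hash k => k + m
  | _, _, seq C D => C.size + D.size
  | _, _, pair C D => C.size + D.size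

/-- Bitwise conjunction of two circuits. -/
def and {m a b : ℕ} (C D : Circ m a b) : Circ m a b :=
  let N : Circ m a b := seq (pair C D) (nand b)
  seq (pair N N) (nand b)

/-- The bit `V`, followed by the output of `C` if that bit is `1` and by zeros otherwise. -/
def guard {m a b : ℕ} (V : Circ m a 1) (C : Circ m a b) : Circ m a (1 + b) :=
  pair V (and (seq V (wire fun _ => 0)) C)

end Circ

/-! ### Encoded sets and hash functions -/

/-- A family of sets whose elements have distinct binary codes of polynomial length. -/
structure Encoded where
  El : ℕ → Type
  len : ℕ → ℕ
  code : ∀ n, El n ↪ Bits (len n)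
  len_poly : PolyBounded len

/-- Hash functions with values in `R`. -/
abbrev HashFn (R : Encoded) (n : ℕ) : Type := List Bool → R.El n

/-- The hash function as it is seen by circuits. -/
def HashFn.toBits {R : Encoded} {n : ℕ} (h : HashFn R n) : List Bool → Bits (R.len n) :=
  fun s => R.code n (h s)

instance (R : Encoded) (n : ℕ) : MeasurableSpace (R.El n) := ⊤

/-- The hash function is either a random oracle or a fixed function. -/
inductive HashModel (R : Encoded) where
  | randomOracle : HashModel R
  | concrete (h : ∀ n, HashFn R n) : HashModel R

/-- The distribution of the hash function; the values of the random oracle at distinct strings are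
independent and uniform. -/
noncomputable def HashModel.law {R : Encoded} [∀ n, Fintype (R.El n)] [∀ n, Nonempty (R.El n)] :
    HashModel R → ∀ n, MeasureTheory.Measure (HashFn R n)
  | randomOracle, n =>
      MeasureTheory.Measure.infinitePi fun _ : List Bool =>
        (PMF.uniformOfFintype (R.El n)).toMeasure
  | concrete h, n => MeasureTheory.Measure.dirac (h n)

/-- The probability that `E` returns `1` on a hash function with law `μ` and `r` independent
uniform coins. -/
noncomputable def prob {R : Encoded} {n : ℕ} (μ : MeasureTheory.Measure (HashFn R n)) (r : ℕ)
    (E : HashFn R n → Bits r → Bool) : ℝ :=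
  (μ.prod (PMF.uniformOfFintype (Bits r)).toMeasure).real {p | E p.1 p.2 = true}

/-! ### Functionalities, machines, protocols -/

/-- An ideal functionality that takes an input of `s n` bits from the server and one of `c n` bits
from the client, and returns `o n` bits to the client and nothing to the server.  It may query the
hash function.  `sDom` and `cDom` are the inputs on which honest parties use it; a dishonest client
may hand in any string. -/
structure Functionality (R : Encoded) (s c o : ℕ → ℕ) where
  sDom : ∀ n, Set (Bits (s n))
  cDom : ∀ n, Set (Bits (c n))
  eval : ∀ n, HashFn R n → Bits (s n) → Bits (c n) → Bits (o n)

/-- One round of a protocol: a message of `w` bits to the server, or to the client, or a joint call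
of an ideal functionality. -/
inductive Round where
  | toServer (w : ℕ) : Round
  | toClient (w : ℕ) : Round
  | call : Round

namespace Round

/-- Number of bits that the client sends in a round, where the functionality that can be called
takes `c` bits from the client. -/
def cSend (c : ℕ) : Round → ℕ
  | toServer w => w
  | toClient _ => 0
  | call => c

/-- Number of bits that the client receives. -/
def cRecv (o : ℕ) : Round → ℕ
  | toServer _ => 0
  | toClient w => w
  | call => o

/-- Number of bits that the server sends. -/
def sSend (s : ℕ) : Round → ℕ
  | toServer _ => 0
  | toClient w => w
  | call => s

/-- Number of bits that the server receives: after a call it is told whether the client has gone on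
(`1`) or has aborted (`0`). -/
def sRecv : Round → ℕ
  | toServer w => w
  | toClient _ => 0
  | call => 1

/-- What the client receives, if the client sends `x` and the server sends `y`. -/
def deliverC {s c o : ℕ} (g : Bits s → Bits c → Bits o) :
    (k : Round) → Bits (k.cSend c) → Bits (k.sSend s) → Bits (k.cRecv o)
  | toServer _, _, _ => Fin.elim0
  | toClient _, _, y => y
  | call, x, y => g y x

/-- What the server receives, if the client sends `x` and then, in a call, the abort bit `b`. -/
def deliverS {c : ℕ} : (k : Round) → Bits (k.cSend c) → Bits 1 → Bits k.sRecv
  | toServer _, x, _ => x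
  | toClient _, _, _ => Fin.elim0
  | call, _, b => b

end Round

/-- An interactive machine for rounds `0, 1, 2, …`: a state of `st` bits is computed from the input
and the coins; in round `i` the machine sends `send i` of its state and updates the state by
`recv i` of the state and the message received; `out` computes the final output. -/
structure Machine (m inLen outLen : ℕ) (sendW recvW : ℕ → ℕ) where
  coins : ℕ
  st : ℕ
  start : Circ m (inLen + coins) st
  send : ∀ i, Circ m st (sendW i)
  recv : ∀ i, Circ m (st + recvW i) st
  out : Circ m st outLen

/-- A machine in the role of the client has to say, after each call of a functionality (and after
having seen its output), whether it goes on (`1`) or aborts (`0`). -/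
structure ClientMachine (m inLen outLen : ℕ) (sendW recvW : ℕ → ℕ) extends
    Machine m inLen outLen sendW recvW where
  confirm : ∀ _ : ℕ, Circ m st 1

/-- The resources used by a machine in an execution of `r` rounds. -/
def Machine.size {m a b : ℕ} {v w : ℕ → ℕ} (M : Machine m a b v w) (r : ℕ) : ℕ :=
  r + M.coins + M.st + M.start.size + M.out.size +
    ∑ i ∈ Finset.range r, ((M.send i).size + (M.recv i).size)

def ClientMachine.totalSize {m a b : ℕ} {v w : ℕ → ℕ} (M : ClientMachine m a b v w) (r : ℕ) : ℕ :=
  M.toMachine.size r + ∑ i ∈ Finset.range r, (M.confirm i).size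

/-- A client (honest or not) in a protocol with rounds `kind`, in which functionalities that take
`gc` bits from the client and return `go` bits can be called. -/
abbrev Client (m gc go : ℕ) (kind : ℕ → Round) (inLen outLen : ℕ) : Type :=
  ClientMachine m inLen outLen (fun i => (kind i).cSend gc) (fun i => (kind i).cRecv go)

/-- A server; its output bit says whether it has accepted (`1`) or aborted (`0`). -/
abbrev Server (m gs : ℕ) (kind : ℕ → Round) (inLen : ℕ) : Type :=
  Machine m inLen 1 (fun i => (kind i).sSend gs) (fun i => (kind i).sRecv)

/-- A two-party protocol in the `G`-hybrid model, for parties with inputs of `s n` and `c n` bits,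
with an output of `o n` bits for the client. -/
structure Protocol (R : Encoded) {gs gc go : ℕ → ℕ} (G : Functionality R gs gc go)
    (s c o : ℕ → ℕ) where
  rounds : ℕ → ℕ
  kind : ℕ → ℕ → Round
  server : ∀ n, Server (R.len n) (gs n) (kind n) (s n)
  client : ∀ n, Client (R.len n) (gc n) (go n) (kind n) (c n) (o n)

/-! ### Execution -/

/-- The states of client and server after `t` rounds. -/
def runStates {m gs gc go a b d : ℕ} {kind : ℕ → Round} (H : List Bool → Bits m)
    (g : Bits gs → Bits gc → Bits go) (C : Client m gc go kind a d) (S : Server m gs kind b)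
    (x : Bits a) (k : Bits b) (rC : Bits C.coins) (rS : Bits S.coins) :
    ℕ → Bits C.st × Bits S.st
  | 0 => (C.start.eval H (Fin.append x rC), S.start.eval H (Fin.append k rS))
  | t + 1 =>
    let p := runStates H g C S x k rC rS t
    let x' := (C.send t).eval H p.1
    let y' := (S.send t).eval H p.2
    let p₁ := (C.recv t).eval H (Fin.append p.1 ((kind t).deliverC g x' y'))
    (p₁, (S.recv t).eval H (Fin.append p.2 ((kind t).deliverS x' ((C.confirm t).eval H p₁))))

/-- The length of the view of the server after `t` rounds. -/
def viewLen (kind : ℕ → Round) (inLen coins : ℕ) : ℕ → ℕ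
  | 0 => inLen + coins
  | t + 1 => viewLen kind inLen coins t + (kind t).sRecv

/-- The view of the server after `t` rounds: its input, its coins, and all that it has received. -/
def serverView {m gs gc go a b d : ℕ} {kind : ℕ → Round} (H : List Bool → Bits m)
    (g : Bits gs → Bits gc → Bits go) (C : Client m gc go kind a d) (S : Server m gs kind b)
    (x : Bits a) (k : Bits b) (rC : Bits C.coins) (rS : Bits S.coins) :
    (t : ℕ) → Bits (viewLen kind b S.coins t)
  | 0 => Fin.append k rS
  | t + 1 =>
    Fin.append (serverView H g C S x k rC rS t)
      ((kind t).deliverS ((C.send t).eval H (runStates H g C S x k rC rS t).1)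
        ((C.confirm t).eval H (runStates H g C S x k rC rS (t + 1)).1))

/-- The output of the client followed by the output bit of the server, after `t` rounds.  The coins
of client and server are the two parts of `r`. -/
def execOut {m gs gc go a b d : ℕ} {kind : ℕ → Round} (H : List Bool → Bits m)
    (g : Bits gs → Bits gc → Bits go) (C : Client m gc go kind a d) (S : Server m gs kind b)
    (x : Bits a) (k : Bits b) (t : ℕ) (r : Bits (C.coins + S.coins)) : Bits (d + 1) :=
  let p := runStates H g C S x k (fun i => r (Fin.castAdd _ i)) (fun i => r (Fin.natAdd _ i)) t
  Fin.append (C.out.eval H p.1) (S.out.eval H p.2)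

/-- The view of the server followed by the outputs of client and server. -/
def execView {m gs gc go a b d : ℕ} {kind : ℕ → Round} (H : List Bool → Bits m)
    (g : Bits gs → Bits gc → Bits go) (C : Client m gc go kind a d) (S : Server m gs kind b)
    (x : Bits a) (k : Bits b) (t : ℕ) (r : Bits (C.coins + S.coins)) :
    Bits (viewLen kind b S.coins t + (d + 1)) :=
  Fin.append
    (serverView H g C S x k (fun i => r (Fin.castAdd _ i)) (fun i => r (Fin.natAdd _ i)) t)
    (execOut H g C S x k t r)

/-! ### The ideal process -/

/-- The rounds of the ideal process: one call of the functionality. -/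
def idealKind : ℕ → Round := fun _ => Round.call

/-- The server that hands its input to the functionality and then accepts unless the client has
aborted. -/
def idealServer (m s : ℕ) : Server m s idealKind s where
  coins := 0
  st := s + 1
  start := Circ.pair (Circ.wire (Fin.castAdd 0)) (Circ.const fun _ => false)
  send := fun _ => Circ.wire (Fin.castAdd 1)
  recv := fun _ => Circ.pair (Circ.wire fun i => Fin.castAdd 1 (Fin.castAdd 1 i))
    (Circ.wire (Fin.natAdd (s + 1)))
  out := Circ.wire (Fin.natAdd s)

/-- The client that hands its input to the functionality, does not abort, and outputs what it has
received. -/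
def idealClient (m c o : ℕ) : Client m c o idealKind c o where
  coins := 0
  st := c + o
  start := Circ.pair (Circ.wire (Fin.castAdd 0)) (Circ.const fun _ => false)
  send := fun _ => Circ.wire (Fin.castAdd o)
  recv := fun _ => Circ.pair (Circ.wire fun i => Fin.castAdd o (Fin.castAdd o i))
    (Circ.wire (Fin.natAdd (c + o)))
  out := Circ.wire (Fin.natAdd c)
  confirm := fun _ => Circ.const fun _ => true

/-- The protocol in the `G`-hybrid model that consists of one call of `G` on the inputs of the
parties. -/
def oneCall {R : Encoded} {s c o : ℕ → ℕ} (G : Functionality R s c o) : Protocol R G s c o where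
  rounds := fun _ => 1
  kind := fun _ => idealKind
  server := fun n => idealServer (R.len n) (s n)
  client := fun n => idealClient (R.len n) (c n) (o n)

/-! ### Security -/

section Security

variable {R : Encoded} {gs gc go s c o : ℕ → ℕ} {G : Functionality R gs gc go}

/-- The honest parties run in polynomial time. -/
def Protocol.Efficient (Pr : Protocol R G s c o) : Prop :=
  PolyBounded (fun n => (Pr.server n).size (Pr.rounds n)) ∧
    PolyBounded (fun n => (Pr.client n).totalSize (Pr.rounds n))

/-- Security against a semi-honest server: a polynomial-time simulator that knows only the input of
the server produces a view which, jointly with the prescribed output of the client and the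
acceptance of the server, cannot be told from the real one, for any inputs, by polynomial-time
distinguishers with access to the hash function. -/
def SecureSemiHonestServer (law : ∀ n, MeasureTheory.Measure (HashFn R n))
    (Pr : Protocol R G s c o) (F : Functionality R s c o) : Prop :=
  ∃ (q : ℕ → ℕ)
    (Sim : ∀ n, Circ (R.len n) (s n + q n)
      (viewLen (Pr.kind n) (s n) (Pr.server n).coins (Pr.rounds n))),
    PolyBounded q ∧ PolyBounded (fun n => (Sim n).size) ∧
    ∀ (k : ∀ n, Bits (s n)) (x : ∀ n, Bits (c n)),
      (∀ n, k n ∈ F.sDom n) → (∀ n, x n ∈ F.cDom n) →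
    ∀ D : ∀ n, Circ (R.len n)
        (viewLen (Pr.kind n) (s n) (Pr.server n).coins (Pr.rounds n) + (o n + 1)) 1,
      PolyBounded (fun n => (D n).size) →
      Negligible fun n =>
        prob (law n) ((Pr.client n).coins + (Pr.server n).coins) (fun h r =>
          (D n).eval h.toBits
            (execView h.toBits (G.eval n h) (Pr.client n) (Pr.server n) (x n) (k n)
              (Pr.rounds n) r) 0) -
        prob (law n) (q n) (fun h r =>
          (D n).eval h.toBits
            (Fin.append ((Sim n).eval h.toBits (Fin.append (k n) r))
              (Fin.append (F.eval n h (k n) (x n)) fun _ : Fin 1 => true)) 0)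

/-- Security against a malicious client: for every polynomial-time adversary `A` in the place of
the client there is a polynomial-time adversary `Sim` in the ideal process for `F` such that, for
any inputs and any auxiliary input, the output of the adversary jointly with that of the honest
server in an execution with `A` cannot be told from the one in the ideal process with `Sim`, by
polynomial-time distinguishers with access to the hash function. -/
def SecureMaliciousClient (law : ∀ n, MeasureTheory.Measure (HashFn R n))
    (Pr : Protocol R G s c o) (F : Functionality R s c o) : Prop :=
  ∀ (aux w : ℕ → ℕ)
    (A : ∀ n, Client (R.len n) (gc n) (go n) (Pr.kind n) (c n + aux n) (w n)),
    PolyBounded aux → PolyBounded (fun n => (A n).totalSize (Pr.rounds n)) →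
  ∃ Sim : ∀ n, Client (R.len n) (c n) (o n) idealKind (c n + aux n) (w n),
    PolyBounded (fun n => (Sim n).totalSize 1) ∧
    ∀ (k : ∀ n, Bits (s n)) (x : ∀ n, Bits (c n)) (z : ∀ n, Bits (aux n)),
      (∀ n, k n ∈ F.sDom n) → (∀ n, x n ∈ F.cDom n) →
    ∀ D : ∀ n, Circ (R.len n) (w n + 1) 1, PolyBounded (fun n => (D n).size) →
      Negligible fun n =>
        prob (law n) ((A n).coins + (Pr.server n).coins) (fun h r =>
          (D n).eval h.toBits
            (execOut h.toBits (G.eval n h) (A n) (Pr.server n) (Fin.append (x n) (z n)) (k n)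
              (Pr.rounds n) r) 0) -
        prob (law n) ((Sim n).coins + (idealServer (R.len n) (s n)).coins) (fun h r =>
          (D n).eval h.toBits
            (execOut h.toBits (F.eval n h) (Sim n) (idealServer (R.len n) (s n))
              (Fin.append (x n) (z n)) (k n) 1 r) 0)

/-- The protocol realizes `F` against a semi-honest server and against a malicious client. -/
def SecurelyRealizes (law : ∀ n, MeasureTheory.Measure (HashFn R n))
    (Pr : Protocol R G s c o) (F : Functionality R s c o) : Prop :=
  Pr.Efficient ∧ SecureSemiHonestServer law Pr F ∧ SecureMaliciousClient law Pr F

end Security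

/-! ### Garbled circuits -/

/-- The functionality for a public circuit family: the server is the garbler, the client is the
evaluator, who learns the output of the circuit. -/
def garbledCircuit {R : Encoded} {a b o : ℕ → ℕ} (C : ∀ n, Circ (R.len n) (a n + b n) (o n)) :
    Functionality R a b o where
  sDom := fun _ => Set.univ
  cDom := fun _ => Set.univ
  eval := fun n h k x => (C n).eval h.toBits (Fin.append k x)

/-- A garbled-circuit construction: a protocol for every circuit family. -/
abbrev GCProtocol (R : Encoded) {gs gc go : ℕ → ℕ} (G : Functionality R gs gc go) : Type :=
  ∀ (a b o : ℕ → ℕ), (∀ n, Circ (R.len n) (a n + b n) (o n)) → Protocol R G a b o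

/-- The construction is secure against a semi-honest garbler and a malicious evaluator, for all
circuit families of polynomial size. -/
def GCProtocol.Secure {R : Encoded} {gs gc go : ℕ → ℕ} {G : Functionality R gs gc go}
    (law : ∀ n, MeasureTheory.Measure (HashFn R n)) (ρ : GCProtocol R G) : Prop :=
  ∀ (a b o : ℕ → ℕ) (C : ∀ n, Circ (R.len n) (a n + b n) (o n)),
    PolyBounded a → PolyBounded b → PolyBounded (fun n => (C n).size) →
    SecurelyRealizes law (ρ a b o C) (garbledCircuit C)

/-! ### Embed-and-map -/

/-- Finite fields `F n`, dimensions `θ n`, and a binary encoding of `F ^ θ`. -/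
structure VecFamily where
  F : ℕ → Type
  [field : ∀ n, Field (F n)]
  [fintype : ∀ n, Fintype (F n)]
  θ : ℕ → ℕ
  len : ℕ → ℕ
  code : ∀ n, (Fin (θ n) → F n) ↪ Bits (len n)
  len_poly : PolyBounded len

/-- The spaces `F ^ θ`. -/
def VecFamily.space (V : VecFamily) : Encoded where
  El := fun n => Fin (V.θ n) → V.F n
  len := V.len
  code := V.code
  len_poly := V.len_poly

/-- The parameters: spaces `F ^ θ`; the universe `U` of client inputs; a keyed embedding of the
universe into `F ^ θ` with key space `KE`; a keyed permutation of `F ^ θ` with key space `KP`. -/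
structure EMParams where
  V : VecFamily
  U : Encoded
  KE : Encoded
  KP : Encoded
  embed : ∀ n, KE.El n → U.El n → V.space.El n
  perm : ∀ n, KP.El n → Equiv.Perm (V.space.El n)

namespace EMParams

/-- The space `F ^ θ`, in which also the hash function takes its values. -/
abbrev M (P : EMParams) : Encoded := P.V.space

instance (P : EMParams) (n : ℕ) : Fintype (P.M.El n) :=
  haveI := P.V.fintype n
  inferInstanceAs (Fintype (Fin (P.V.θ n) → P.V.F n))

instance (P : EMParams) (n : ℕ) : Nonempty (P.M.El n) :=
  haveI := P.V.field n
  inferInstanceAs (Nonempty (Fin (P.V.θ n) → P.V.F n))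

/-- Length of the server's input, the keys `(kₑ, k₁, k₂)`. -/
abbrev keyLen (P : EMParams) (n : ℕ) : ℕ := P.KE.len n + (P.KP.len n + P.KP.len n)

/-- Length of the client's output: a bit that says that there is an output, and `(p₁, p₂)`. -/
abbrev resLen (P : EMParams) (n : ℕ) : ℕ := 1 + (P.M.len n + P.M.len n)

/-- The code of `(kₑ, k₁, k₂)`. -/
def codeKeys (P : EMParams) (n : ℕ) (ke : P.KE.El n) (k₁ k₂ : P.KP.El n) : Bits (P.keyLen n) :=
  Fin.append (P.KE.code n ke) (Fin.append (P.KP.code n k₁) (P.KP.code n k₂))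

/-- The string `(x, z, kₑ)` to which the hash function is applied. -/
def hashInput (P : EMParams) (n : ℕ) (x : P.U.El n) (z : P.M.El n) (ke : P.KE.El n) : List Bool :=
  List.ofFn (P.U.code n x) ++ List.ofFn (P.M.code n z) ++ List.ofFn (P.KE.code n ke)

/-- `p₁ = π_{k₁}(embed_{kₑ}(x))` -/
def p₁ (P : EMParams) (n : ℕ) (ke : P.KE.El n) (k₁ : P.KP.El n) (x : P.U.El n) : P.M.El n :=
  P.perm n k₁ (P.embed n ke x)

/-- `p₂ = π_{k₂}(h(x, embed_{kₑ}(x), kₑ))` -/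
def p₂ (P : EMParams) (n : ℕ) (h : HashFn P.M n) (ke : P.KE.El n) (k₂ : P.KP.El n)
    (x : P.U.El n) : P.M.El n :=
  P.perm n k₂ (h (P.hashInput n x (P.embed n ke x) ke))

/-- `y` is the output for the server's input `k` and the client's input `w`: the keys
`(kₑ, k₁, k₂)` and the element `x` of the universe that they encode determine `(p₁, p₂)`. -/
def IsResult (P : EMParams) (n : ℕ) (h : HashFn P.M n) (k : Bits (P.keyLen n))
    (w : Bits (P.U.len n)) (y : Bits (P.resLen n)) : Prop :=
  ∃ (ke : P.KE.El n) (k₁ k₂ : P.KP.El n) (x : P.U.El n),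
    k = P.codeKeys n ke k₁ k₂ ∧ w = P.U.code n x ∧
    y = Fin.append (fun _ : Fin 1 => true)
      (Fin.append (P.M.code n (P.p₁ n ke k₁ x)) (P.M.code n (P.p₂ n h ke k₂ x)))

open Classical in
/-- The embed-and-map functionality.  From the keys `(kₑ, k₁, k₂)` of the server and `x` of the
client it computes `(p₁, p₂)` for the client.  If the client hands in a string that does not encode
an element of the universe, it gets `⊥`, encoded by zeros. -/
noncomputable def functionality (P : EMParams) : Functionality P.M P.keyLen P.U.len P.resLen where
  sDom := fun n => {k | ∃ ke k₁ k₂, k = P.codeKeys n ke k₁ k₂}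
  cDom := fun n => Set.range (P.U.code n)
  eval := fun n h k w => if H : ∃ y, P.IsResult n h k w y then H.choose else fun _ => false

/-- The functionality on encodings of keys and of an element of the universe. -/
theorem functionality_eval (P : EMParams) (n : ℕ) (h : HashFn P.M n) (ke : P.KE.El n)
    (k₁ k₂ : P.KP.El n) (x : P.U.El n) :
    P.functionality.eval n h (P.codeKeys n ke k₁ k₂) (P.U.code n x) =
      Fin.append (fun _ : Fin 1 => true)
        (Fin.append (P.M.code n (P.p₁ n ke k₁ x)) (P.M.code n (P.p₂ n h ke k₂ x))) := by
  have H : ∃ y, P.IsResult n h (P.codeKeys n ke k₁ k₂) (P.U.code n x) y :=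
    ⟨_, ke, k₁, k₂, x, rfl, rfl, rfl⟩
  have key : ∀ {a b : ℕ} {u u' : Bits a} {v v' : Bits b},
      Fin.append u v = Fin.append u' v' → u = u' ∧ v = v' := by
    intro a b u u' v v' e
    constructor
    · funext i
      simpa using congrFun e (Fin.castAdd b i)
    · funext i
      simpa using congrFun e (Fin.natAdd a i)
  obtain ⟨ke', k₁', k₂', x', hk, hw, hy⟩ := H.choose_spec
  have e₁ := key hk
  have e₂ := key e₁.2
  obtain rfl := (P.KE.code n).injective e₁.1
  obtain rfl := (P.KP.code n).injective e₂.1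
  obtain rfl := (P.KP.code n).injective e₂.2
  obtain rfl := (P.U.code n).injective hw
  simp only [functionality]
  rw [dif_pos H]
  exact hy

end EMParams

/-- Circuits of polynomial size for the embedding and for the permutation, and one that recognizes
the codes of elements of the universe. -/
structure EMCircuits (P : EMParams) where
  embedC : ∀ n, Circ (P.M.len n) (P.KE.len n + P.U.len n) (P.M.len n)
  embed_spec : ∀ n H ke x, (embedC n).eval H (Fin.append (P.KE.code n ke) (P.U.code n x)) =
    P.M.code n (P.embed n ke x)
  embed_poly : PolyBounded fun n => (embedC n).size
  permC : ∀ n, Circ (P.M.len n) (P.KP.len n + P.M.len n) (P.M.len n)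
  perm_spec : ∀ n H (k : P.KP.El n) (v : P.M.El n),
    (permC n).eval H (Fin.append (P.KP.code n k) (P.M.code n v)) = P.M.code n (P.perm n k v)
  perm_poly : PolyBounded fun n => (permC n).size
  validC : ∀ n, Circ (P.M.len n) (P.U.len n) 1
  valid_spec : ∀ n H w, (validC n).eval H w 0 = true ↔ w ∈ Set.range (P.U.code n)
  valid_poly : PolyBounded fun n => (validC n).size

namespace EMCircuits

variable {P : EMParams} (E : EMCircuits P) (n : ℕ)

/-- The circuits that select `kₑ`, `k₁`, `k₂` and `x` from the inputs of the parties. -/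
def selE : Circ (P.M.len n) (P.keyLen n + P.U.len n) (P.KE.len n) :=
  Circ.wire fun i => Fin.castAdd (P.U.len n) (Fin.castAdd (P.KP.len n + P.KP.len n) i)

def selK₁ : Circ (P.M.len n) (P.keyLen n + P.U.len n) (P.KP.len n) :=
  Circ.wire fun i =>
    Fin.castAdd (P.U.len n) (Fin.natAdd (P.KE.len n) (Fin.castAdd (P.KP.len n) i))

def selK₂ : Circ (P.M.len n) (P.keyLen n + P.U.len n) (P.KP.len n) :=
  Circ.wire fun i =>
    Fin.castAdd (P.U.len n) (Fin.natAdd (P.KE.len n) (Fin.natAdd (P.KP.len n) i))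

def selX : Circ (P.M.len n) (P.keyLen n + P.U.len n) (P.U.len n) :=
  Circ.wire (Fin.natAdd (P.keyLen n))

/-- Computes `v = embed_{kₑ}(x)`. -/
def vC : Circ (P.M.len n) (P.keyLen n + P.U.len n) (P.M.len n) :=
  ((selE n).pair (selX n)).seq (E.embedC n)

/-- Computes `p₁ = π_{k₁}(v)`. -/
def p₁C : Circ (P.M.len n) (P.keyLen n + P.U.len n) (P.M.len n) :=
  ((selK₁ n).pair (E.vC n)).seq (E.permC n)

/-- Computes `p₂ = π_{k₂}(h(x, v, kₑ))`. -/
def p₂C : Circ (P.M.len n) (P.keyLen n + P.U.len n) (P.M.len n) :=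
  ((selK₂ n).pair ((((selX n).pair (E.vC n)).pair (selE n)).seq (Circ.hash _))).seq (E.permC n)

/-- The circuit of the embed-and-map protocol: it outputs `(p₁, p₂)`, provided that the input of the
client encodes an element of the universe. -/
def circuit : Circ (P.M.len n) (P.keyLen n + P.U.len n) (P.resLen n) :=
  Circ.guard ((selX n).seq (E.validC n)) ((E.p₁C n).pair (E.p₂C n))

/-- The embed-and-map protocol in the hybrid model with the garbled-circuit functionality: the
parties call it for the circuit above, as garbler and evaluator, on their inputs. -/
def hybridProtocol :
    Protocol P.M (garbledCircuit fun n => E.circuit n) P.keyLen P.U.len P.resLen :=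
  oneCall (garbledCircuit fun n => E.circuit n)

/-- The embed-and-map protocol with a garbled-circuit construction `ρ`: server and client run `ρ`
for the circuit above, as garbler and evaluator, on their inputs. -/
def protocol {gs gc go : ℕ → ℕ} {G : Functionality P.M gs gc go} (ρ : GCProtocol P.M G) :
    Protocol P.M G P.keyLen P.U.len P.resLen :=
  ρ P.keyLen P.U.len P.resLen fun n => E.circuit n

end EMCircuits

/-! ### Polynomial bounds -/

/-! The embed-and-map circuit computes the functionality exactly, as soon as the server's input
encodes keys: then `eval_circuit` gives equality for every hash function and every client string,
with the validity guard producing `⊥` on strings outside the universe. Only the server's input needs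
to be honest, and in both security notions it is.

Security for a functionality depends on it only through its values at the honest server's input, for
arbitrary client strings, because the ideal server always submits its own input. So a realization of
the garbled-circuit functionality is a realization of embed-and-map with the same simulators
(`SecurelyRealizes.congr`).

In the hybrid model a single ideal call realizes the called functionality perfectly
(`oneCall_securelyRealizes`). For a construction `ρ`, the protocol is `ρ` run on the circuit, so no
composition theorem is needed, only the polynomial bounds that security of `ρ` asks for. All
comparisons of functionalities hold for each hash function separately, so random oracle and fixed
function need no separate treatment. -/

theorem PolyBounded.of_le {f g : ℕ → ℕ} (hg : PolyBounded g) (h : ∀ n, f n ≤ g n) :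
    PolyBounded f := by
  obtain ⟨p, hp⟩ := hg
  exact ⟨p, fun n => (h n).trans (hp n)⟩

theorem PolyBounded.add {f g : ℕ → ℕ} (hf : PolyBounded f) (hg : PolyBounded g) :
    PolyBounded fun n => f n + g n := by
  obtain ⟨p, hp⟩ := hf
  obtain ⟨q, hq⟩ := hg
  exact ⟨p + q, fun n => by simpa using Nat.add_le_add (hp n) (hq n)⟩

theorem PolyBounded.const (k : ℕ) : PolyBounded fun _ => k :=
  ⟨Polynomial.C k, fun n => by simp⟩

theorem PolyBounded.const_mul (k : ℕ) {f : ℕ → ℕ} (hf : PolyBounded f) :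
    PolyBounded fun n => k * f n := by
  obtain ⟨p, hp⟩ := hf
  exact ⟨Polynomial.C k * p, fun n => by simpa using Nat.mul_le_mul_left k (hp n)⟩

theorem negligible_zero : Negligible fun _ => 0 :=
  Asymptotics.superpolynomialDecay_zero _ _

/-! ### Evaluation and size of guarded circuits -/

namespace Circ

/-- The outer NAND receives two copies of the same wires and thus acts as a negation of the inner
NAND. -/
theorem eval_and {m a b : ℕ} (H : List Bool → Bits m) (C D : Circ m a b) (x : Bits a) :
    (Circ.and C D).eval H x = fun i => C.eval H x i && D.eval H x i := by
  funext i
  simp only [Circ.and, eval, Fin.append_left, Fin.append_right, Bool.and_self, Bool.not_not]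

/-- A flag `0` blanks every output wire, which is exactly the encoding of `⊥`. -/
theorem eval_guard {m a b : ℕ} (H : List Bool → Bits m) (V : Circ m a 1) (C : Circ m a b)
    (x : Bits a) :
    (Circ.guard V C).eval H x =
      Fin.append (V.eval H x) (fun i => V.eval H x 0 && C.eval H x i) := by
  simp [Circ.guard, eval, eval_and]

/-- `Circ.and` repeats its inner NAND circuit, and the guard uses `V` once more for the flag. Hence
the blow-up is by a constant factor only. -/
theorem size_guard {m a b : ℕ} (V : Circ m a 1) (C : Circ m a b) :
    (Circ.guard V C).size = 3 * V.size + 2 * C.size + 5 * b := by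
  simp only [Circ.guard, Circ.and, size]
  ring

end Circ

/-! ### The embed-and-map circuit -/

namespace EMCircuits

variable {P : EMParams} (E : EMCircuits P) (n : ℕ)

section Selectors

variable (H : List Bool → Bits (P.M.len n)) (ke : Bits (P.KE.len n)) (k₁ k₂ : Bits (P.KP.len n))
  (w : Bits (P.U.len n))

theorem eval_selE :
    (selE n).eval H (Fin.append (Fin.append ke (Fin.append k₁ k₂)) w) = ke := by
  funext i
  simp [selE, Circ.eval]

theorem eval_selK₁ :
    (selK₁ n).eval H (Fin.append (Fin.append ke (Fin.append k₁ k₂)) w) = k₁ := by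
  funext i
  simp [selK₁, Circ.eval]

theorem eval_selK₂ :
    (selK₂ n).eval H (Fin.append (Fin.append ke (Fin.append k₁ k₂)) w) = k₂ := by
  funext i
  simp only [selK₂, Circ.eval, Fin.append_left, Fin.append_right]

theorem eval_selX (k : Bits (P.keyLen n)) :
    (selX n).eval H (Fin.append k w) = w := by
  funext i
  simp [selX, Circ.eval]

end Selectors

variable (ke : P.KE.El n) (k₁ k₂ : P.KP.El n) (x : P.U.El n)

theorem eval_vC (H : List Bool → Bits (P.M.len n)) :
    (E.vC n).eval H (Fin.append (P.codeKeys n ke k₁ k₂) (P.U.code n x)) =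
      P.M.code n (P.embed n ke x) := by
  simp only [vC, Circ.eval, EMParams.codeKeys, eval_selE, eval_selX, E.embed_spec]

theorem eval_p₁C (H : List Bool → Bits (P.M.len n)) :
    (E.p₁C n).eval H (Fin.append (P.codeKeys n ke k₁ k₂) (P.U.code n x)) =
      P.M.code n (P.p₁ n ke k₁ x) := by
  simp only [p₁C, Circ.eval, eval_vC]
  simp only [EMParams.codeKeys, eval_selK₁, E.perm_spec, EMParams.p₁]

/-- Unlike for `p₁`, the hash gates must answer with codes of elements of the space, since
`E.perm_spec` says nothing about other strings. This is why `h.toBits` replaces an arbitrary `H`. -/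
theorem eval_p₂C (h : HashFn P.M n) :
    (E.p₂C n).eval h.toBits (Fin.append (P.codeKeys n ke k₁ k₂) (P.U.code n x)) =
      P.M.code n (P.p₂ n h ke k₂ x) := by
  simp only [p₂C, Circ.eval, eval_vC]
  simp only [EMParams.codeKeys, eval_selK₂, eval_selE, eval_selX, List.ofFn_fin_append,
    HashFn.toBits, E.perm_spec, EMParams.p₂, EMParams.hashInput]

/-- On codes of keys and on any client string, the circuit computes the functionality. -/
theorem eval_circuit (h : HashFn P.M n) {k : Bits (P.keyLen n)} (hk : k ∈ P.functionality.sDom n)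
    (w : Bits (P.U.len n)) :
    (E.circuit n).eval h.toBits (Fin.append k w) = P.functionality.eval n h k w := by
  obtain ⟨ke, k₁, k₂, rfl⟩ := hk
  rw [circuit, Circ.eval_guard]
  simp only [Circ.eval, eval_selX]
  -- Both cases matter, since a malicious client may submit any string.
  by_cases hw : w ∈ Set.range (P.U.code n)
  · have hv := (E.valid_spec n h.toBits w).2 hw
    obtain ⟨x, rfl⟩ := hw
    rw [P.functionality_eval, eval_p₁C, eval_p₂C, hv]
    congr 1
    funext i
    rw [Subsingleton.elim i 0, hv]
  · have hv : (E.validC n).eval h.toBits w 0 = false := by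
      rw [← Bool.not_eq_true, E.valid_spec]
      exact hw
    -- No result exists for an invalid string, so the functionality takes its default value, all
    -- zeros, which is also what the guard outputs.
    have hno : ¬ ∃ y, P.IsResult n h (P.codeKeys n ke k₁ k₂) w y := by
      rintro ⟨_, _, _, _, x, -, hx, -⟩
      exact hw ⟨x, hx.symm⟩
    simp only [EMParams.functionality, dif_neg hno, hv, Bool.false_and]
    funext i
    refine Fin.addCases (fun j => ?_) (fun j => ?_) i
    · rw [Fin.append_left, Subsingleton.elim j 0, hv]
    · rw [Fin.append_right]

variable (P) in
theorem polyBounded_keyLen : PolyBounded P.keyLen :=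
  P.KE.len_poly.add (P.KP.len_poly.add P.KP.len_poly)

variable (P) in
theorem polyBounded_resLen : PolyBounded P.resLen :=
  (PolyBounded.const 1).add (P.M.len_poly.add P.M.len_poly)

/-- The size is a fixed linear combination of the code lengths and the sizes of the three given
circuits. The largest coefficient is 14, that of `P.M.len`, so 20 leaves room. -/
theorem polyBounded_size_circuit : PolyBounded fun n => (E.circuit n).size := by
  have hL := P.KE.len_poly.add (P.KP.len_poly.add (P.U.len_poly.add P.M.len_poly))
  have hC := E.embed_poly.add (E.perm_poly.add E.valid_poly)
  refine ((hL.add hC).const_mul 20 |>.add (PolyBounded.const 5)).of_le fun n => ?_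
  rw [circuit, Circ.size_guard]
  simp only [Circ.size, p₁C, p₂C, vC, selE, selK₁, selK₂, selX]
  omega

end EMCircuits

/-! ### Ideal calls, and change of the functionality -/

section Security

variable {R : Encoded} {gs gc go s c o : ℕ → ℕ}

/-- The execution with the ideal server calls the functionality on the server's input only. -/
theorem execOut_idealServer_congr {m s c o a d : ℕ} (H : List Bool → Bits m)
    {g g' : Bits s → Bits c → Bits o} {k : Bits s} (hg : g k = g' k)
    (C : Client m c o idealKind a d) (x : Bits a)
    (r : Bits (C.coins + (idealServer m s).coins)) :
    execOut H g C (idealServer m s) x k 1 r = execOut H g' C (idealServer m s) x k 1 r := by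
  -- The ideal server stores its input in the first `s` wires of its state and sends these, whatever
  -- the client does. The functionality is therefore evaluated at `k` alone.
  have hsend : ∀ rS : Bits 0, ((idealServer m s).send 0).eval H
      ((idealServer m s).start.eval H (Fin.append k rS)) = k := by
    intro rS
    funext i
    exact (Fin.append_left _ _ i).trans (Fin.append_left _ _ i)
  have hd : ∀ (x' : Bits c) (rS : Bits 0), (idealKind 0).deliverC g x'
        (((idealServer m s).send 0).eval H
          ((idealServer m s).start.eval H (Fin.append k rS))) =
      (idealKind 0).deliverC g' x' (((idealServer m s).send 0).eval H
          ((idealServer m s).start.eval H (Fin.append k rS))) := by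
    intro x' rS
    rw [hsend]
    exact congrFun hg x'
  simp only [execOut, runStates]
  erw [hd]

/-- A realization of `F` realizes every functionality that agrees with `F` on the honest inputs
of the server. -/
theorem SecurelyRealizes.congr {G : Functionality R gs gc go}
    {law : ∀ n, MeasureTheory.Measure (HashFn R n)} {Pr : Protocol R G s c o}
    {F F' : Functionality R s c o} (hP : SecurelyRealizes law Pr F)
    (hs : ∀ n, F'.sDom n ⊆ F.sDom n) (hc : ∀ n, F'.cDom n ⊆ F.cDom n)
    (he : ∀ n h, ∀ k ∈ F'.sDom n, F.eval n h k = F'.eval n h k) :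
    SecurelyRealizes law Pr F' := by
  -- Both simulators are kept; the smaller domains only restrict the inputs to be tested.
  obtain ⟨hE, ⟨q, Sim, hq, hSim, hsh⟩, hmc⟩ := hP
  refine ⟨hE, ⟨q, Sim, hq, hSim, fun k x hk hx D hD => ?_⟩, fun aux w A haux hA => ?_⟩
  · have key := hsh k x (fun n => hs n (hk n)) (fun n => hc n (hx n)) D hD
    simp only [fun n h => he n h (k n) (hk n)] at key
    exact key
  · obtain ⟨Sim, hSim, hs'⟩ := hmc aux w A haux hA
    refine ⟨Sim, hSim, fun k x z hk hx D hD => ?_⟩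
    have key := hs' k x z (fun n => hs n (hk n)) (fun n => hc n (hx n)) D hD
    -- The ideal adversary chooses its own string, so agreement is needed on all client strings and
    -- not just on `F'.cDom`.
    simp only [fun n h r => execOut_idealServer_congr (HashFn.toBits h) (he n h (k n) (hk n))
      (Sim n) (Fin.append (x n) (z n)) r] at key
    exact key

/-- One call of a functionality realizes it. -/
theorem oneCall_securelyRealizes (law : ∀ n, MeasureTheory.Measure (HashFn R n))
    (F : Functionality R s c o) (hs : PolyBounded s) (hc : PolyBounded c) (ho : PolyBounded o) :
    SecurelyRealizes law (oneCall F) F := by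
  -- The server's view is its input and the bit saying that the client went on, so the simulator
  -- appends a constant `1` and needs no coins. Against a malicious client, the adversary `A` is its
  -- own simulator.
  refine ⟨⟨?_, ?_⟩, ⟨fun _ => 0, fun n => Circ.pair (Circ.wire id) (Circ.const fun _ => true),
    PolyBounded.const 0, ?_, fun k x _ _ D _ => ?_⟩, fun aux w A _ hA =>
      ⟨A, hA, fun k x z _ _ D _ => ?_⟩⟩
  · refine ((hs.const_mul 10).add (PolyBounded.const 10)).of_le fun n => ?_
    simp [oneCall, Machine.size, idealServer, Circ.size, idealKind, Round.sSend, Round.sRecv]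
    omega
  · refine (((hc.add ho).const_mul 10).add (PolyBounded.const 10)).of_le fun n => ?_
    simp [oneCall, ClientMachine.totalSize, Machine.size, idealClient, Circ.size, idealKind,
      Round.cSend, Round.cRecv]
    omega
  · refine (hs.add (PolyBounded.const 1)).of_le fun n => ?_
    exact le_rfl
  -- Real and simulated experiments agree pointwise in the hash function and the coins, so the
  -- advantage is zero. The view, the client's output and the server's bit are compared in turn.
  · refine (congrArg Negligible (funext fun n => sub_eq_zero.2 ?_)).mpr negligible_zero
    refine congrArg (prob (law n) 0) (funext fun h => funext fun r => ?_)
    refine congrArg (fun v => (D n).eval h.toBits v 0) ?_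
    refine congrArg₂ Fin.append ?_ (congrArg₂ Fin.append ?_ ?_)
    · refine congrArg₂ Fin.append (congrArg (Fin.append (k n)) ?_) rfl
      exact Subsingleton.elim (α := Bits 0) _ _
    · funext i
      refine ((Fin.append_right _ _ i).trans (Fin.append_right _ _ i)).trans ?_
      refine congrFun (congrArg₂ (F.eval n h) ?_ ?_) i
      · funext j
        exact (Fin.append_left _ _ j).trans (Fin.append_left _ _ j)
      · funext j
        exact (Fin.append_left _ _ j).trans (Fin.append_left _ _ j)
    · funext i
      exact (Fin.append_right _ _ i).trans (Fin.append_right _ _ i)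
  · refine (congrArg Negligible (funext fun n => sub_eq_zero.2 ?_)).mpr negligible_zero
    -- The hybrid execution with `A` is literally the ideal process with `A`: same server, same
    -- single call.
    rfl

end Security

/-! ### Security of embed-and-map -/

theorem mainTheorem5 (P : EMParams) (E : EMCircuits P) (𝓗 : HashModel P.M) :
    SecurelyRealizes 𝓗.law E.hybridProtocol P.functionality ∧
    ∀ (gs gc go : ℕ → ℕ) (G : Functionality P.M gs gc go) (ρ : GCProtocol P.M G),
      ρ.Secure 𝓗.law → SecurelyRealizes 𝓗.law (E.protocol ρ) P.functionality := by
  have hks := EMCircuits.polyBounded_keyLen P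
  -- The garbled-circuit functionality admits all strings as inputs, so the domain conditions are
  -- trivial and `eval_circuit` supplies the agreement on codes of keys.
  have transfer : ∀ {gs gc go : ℕ → ℕ} {G : Functionality P.M gs gc go}
      {Pr : Protocol P.M G P.keyLen P.U.len P.resLen},
      SecurelyRealizes 𝓗.law Pr (garbledCircuit fun n => E.circuit n) →
      SecurelyRealizes 𝓗.law Pr P.functionality := fun hPr =>
    hPr.congr (fun n => Set.subset_univ _) (fun n => Set.subset_univ _)
      fun n h k hk => funext fun w => E.eval_circuit n h hk w
  exact ⟨transfer (oneCall_securelyRealizes _ _ hks P.U.len_poly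
      (EMCircuits.polyBounded_resLen P)),
    fun gs gc go G ρ hρ => transfer
      (hρ _ _ _ _ hks P.U.len_poly E.polyBounded_size_circuit)⟩
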